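/- Let $M$ be a smooth manifold of dimension $2n+1$ with an almost contact complex Riemannian structure $(\varphi,\xi,\eta,g)$; that is, $\varphi$ is a smooth field of endomorphisms of $TM$, $\xi$ a smooth vector field, $\eta$ a smooth 1-form and $g$ a pseudo-Riemannian metric of signature $(n+1,n)$ with $$\varphi\xi=0,\quad \varphi^2=-\mathrm{Id}+\eta\otimes\xi,\quad \eta\circ\varphi=0,\quad \eta(\xi)=1,\quad g(\varphi x,\varphi y)=-g(x,y)+\eta(x)\eta(y).$$ Let $H=\ker\eta$, let $\nabla$ be the Levi-Civita connection of $g$, and put $F(x,y,z)=g((\nabla_x\varphi)y,z)$. Assume that the structure is Sasaki-like, i.e. for all smooth horizontal vector fields $X,Y,Z$ (sections of $H$) $$F(X,Y,Z)=F(\xi,Y,Z)=F(\xi,\xi,Z)=0,\qquad F(X,Y,\xi)=-g(X,Y).$$ Let $R(x,y)z=\nabla_x\nabla_yz-\nabla_y\nabla_xz-\nabla_{[x,y]}z$, $R(x,y,z,u)=g(R(x,y)z,u)$ and $Ric(x,y)=\sum_{i=0}^{2n}\varepsilon_iR(e_i,x,y,e_i)$, where $e_0,\dots,e_{2n}$ is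 an orthonormal basis of the tangent space, $g(e_i,e_j)=\varepsilon_i\delta_{ij}$ with $\varepsilon_i=1$ for $i\le n$ and $\varepsilon_i=-1$ for $i>n$. Then for all smooth vector fields $x,y,z,u$ $$\begin{aligned}R(x,y,\varphi z,u)-R(x,y,z,\varphi u)={}&[g(y,z)-2\eta(y)\eta(z)]\,g(x,\varphi u)+[g(y,u)-2\eta(y)\eta(u)]\,g(x,\varphi z)\\&-[g(x,z)-2\eta(x)\eta(z)]\,g(y,\varphi u)-[g(x,u)-2\eta(x)\eta(u)]\,g(y,\varphi z).\end{aligned}$$ In particular, for all smooth vector fields $x,y$ and all smooth horizontal vector fields $X$, $$R(x,y)\xi=\eta(y)x-\eta(x)y,\qquad [X,\xi]\in H,\qquad \nabla_\xi X=-\varphi X-[X,\xi]\in H,$$ $$R(\xi,X)\xi=-X,\qquad Ric(y,\xi)=2n\,\eta(y),\qquad Ric(\xi,\xi)=2n.$$ -/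

import Mathlib

open scoped Manifold ContDiff Bundle
open VectorField

noncomputable section

namespace SasakiLike

/-- The model space `ℝ^(2n+1)`. -/
abbrev Model (n : ℕ) : Type := EuclideanSpace ℝ (Fin (2 * n + 1))

/-- The tangent space `T_p M` of a `(2n+1)`-dimensional manifold (without boundary). -/
abbrev Tan (n : ℕ) {M : Type*} [TopologicalSpace M] [ChartedSpace (Model n) M] (p : M) : Type :=
  TangentSpace (𝓡 (2 * n + 1)) p

/-- The sign `ε_i` of the `i`-th vector of an orthonormal basis `e_0, …, e_{2n}` in signature
`(n+1, n)`: `ε_i = 1` for `i = 0, …, n` and `ε_i = -1` for `i = n+1, …, 2n`. -/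
def sgn (n : ℕ) (i : Fin (2 * n + 1)) : ℝ := if (i : ℕ) ≤ n then 1 else -1

/-- A basis `e_0, …, e_{2n}` is orthonormal of signature `(n+1, n)` for a bilinear form `B`:
`B(e_i, e_j) = ε_i δ_ij`. -/
def IsOrthonormal {n : ℕ} {M : Type*} [TopologicalSpace M] [ChartedSpace (Model n) M] {p : M}
    (B : Tan n p →L[ℝ] Tan n p →L[ℝ] ℝ) (e : Module.Basis (Fin (2 * n + 1)) ℝ (Tan n p)) : Prop :=
  ∀ i j, B (e i) (e j) = if i = j then sgn n i else 0

section

variable (n : ℕ) (M : Type*) [TopologicalSpace M] [ChartedSpace (Model n) M]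

/-- Arbitrary (not necessarily continuous) vector fields on `M`. -/
abbrev VField : Type _ := Π p : M, TangentSpace (𝓡 (2 * n + 1)) p

variable {n M}

/-- The Lie bracket `[X, Y]` of vector fields. -/
def bracket (X Y : VField n M) : VField n M := mlieBracket (𝓡 (2 * n + 1)) X Y

/-- The derivative `X f` of a function along a vector field. -/
def dirDeriv (X : VField n M) (f : M → ℝ) (p : M) : ℝ := mvfderiv (𝓡 (2 * n + 1)) f p (X p)

variable [IsManifold (𝓡 (2 * n + 1)) ∞ M]

/-- The vector field `X` is differentiable at the point `p`. -/
abbrev DiffAt (X : VField n M) (p : M) : Prop :=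
  MDifferentiableAt (𝓡 (2 * n + 1)) ((𝓡 (2 * n + 1)).prod 𝓘(ℝ, Model n)) (T% X) p

/-- `X` is a smooth vector field on `M`. -/
abbrev Smooth (X : VField n M) : Prop :=
  ContMDiff (𝓡 (2 * n + 1)) ((𝓡 (2 * n + 1)).prod 𝓘(ℝ, Model n)) ∞ (T% X)

variable (n M) in
/-- A smooth pseudo-Riemannian metric of signature `(n+1, n)` on a `(2n+1)`-dimensional
manifold. -/
structure PseudoMetric where
  /-- the bilinear form on each tangent space -/
  val : Π p : M, Tan n p →L[ℝ] Tan n p →L[ℝ] ℝ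
  symm : ∀ (p : M) (v w : Tan n p), val p v w = val p w v
  signature : ∀ p : M, ∃ e, IsOrthonormal (val p) e
  contMDiff : ContMDiff (𝓡 (2 * n + 1))
    ((𝓡 (2 * n + 1)).prod 𝓘(ℝ, Model n →L[ℝ] Model n →L[ℝ] ℝ)) ∞
    (fun p ↦ Bundle.TotalSpace.mk' (Model n →L[ℝ] Model n →L[ℝ] ℝ)
      (E := fun p : M ↦ Tan n p →L[ℝ] Tan n p →L[ℝ] ℝ) p (val p))

namespace PseudoMetric

variable (g : PseudoMetric n M)

/-- The function `g(X, Y)` on `M`. -/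
def app (X Y : VField n M) (p : M) : ℝ := g.val p (X p) (Y p)

/-- The right-hand side of the Koszul formula:
`X g(Y,Z) + Y g(Z,X) - Z g(X,Y) + g([X,Y],Z) - g([Y,Z],X) + g([Z,X],Y)`. -/
def koszul (X Y Z : VField n M) (p : M) : ℝ :=
  dirDeriv X (g.app Y Z) p + dirDeriv Y (g.app Z X) p - dirDeriv Z (g.app X Y) p
    + g.app (bracket X Y) Z p - g.app (bracket Y Z) X p + g.app (bracket Z X) Y p

theorem nondegenerate {p : M} {v : Tan n p} (h : ∀ w, g.val p v w = 0) : v = 0 := by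
  obtain ⟨e, he⟩ := g.signature p
  refine e.ext_elem fun j ↦ ?_
  have h1 := h (e j)
  rw [← e.sum_repr v] at h1
  simp only [map_sum, map_smul, _root_.sum_apply, _root_.smul_apply,
    he _ _, smul_eq_mul, mul_ite, mul_zero, Finset.sum_ite_eq', Finset.mem_univ, if_true] at h1
  have h2 : sgn n j ≠ 0 := by unfold sgn; split_ifs <;> norm_num
  simpa [h2] using h1

theorem app_mdifferentiableAt {X Y : VField n M} {p : M} (hX : DiffAt X p) (hY : DiffAt Y p) :
    MDifferentiableAt (𝓡 (2 * n + 1)) 𝓘(ℝ, ℝ) (g.app X Y) p := by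
  have : MDifferentiableAt (𝓡 (2 * n + 1)) ((𝓡 (2 * n + 1)).prod 𝓘(ℝ, ℝ))
      (fun m ↦ Bundle.TotalSpace.mk' ℝ (E := Bundle.Trivial M ℝ) m (g.val m (X m) (Y m))) p := by
    apply MDifferentiableAt.clm_bundle_apply₂ (F₁ := Model n) (F₂ := Model n)
    · exact g.contMDiff.contMDiffAt.mdifferentiableAt (by simp)
    · exact hX
    · exact hY
  rw [mdifferentiableAt_totalSpace] at this
  exact this.2

theorem koszul_tensorial {X Y : VField n M} {p : M} (hX : DiffAt X p) (hY : DiffAt Y p) :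
    TensorialAt (𝓡 (2 * n + 1)) (Model n) (fun Z : VField n M ↦ g.koszul X Y Z p) p where
  smul {f Z} hf hZ := by
    have hYZ := g.app_mdifferentiableAt hY hZ
    have hZX := g.app_mdifferentiableAt hZ hX
    have e1 : g.app Y (f • Z) = fun q ↦ f q * g.app Y Z q := by ext; simp [app]
    have e2 : g.app (f • Z) X = fun q ↦ f q * g.app Z X q := by ext; simp [app]
    simp only [koszul, dirDeriv, e1, e2, mvfderiv_fun_mul hf hYZ, mvfderiv_fun_mul hf hZX]
    simp [app, bracket, mlieBracket_smul_right hf hZ, mlieBracket_smul_left hf hZ]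
    rw [g.symm p (Z p) (Y p), g.symm p (Z p) (X p)]
    ring
  add {Z Z'} hZ hZ' := by
    have e1 : g.app Y (Z + Z') = fun q ↦ g.app Y Z q + g.app Y Z' q := by ext; simp [app]
    have e2 : g.app (Z + Z') X = fun q ↦ g.app Z X q + g.app Z' X q := by ext; simp [app]
    simp only [koszul, dirDeriv, e1, e2,
      mvfderiv_fun_add (g.app_mdifferentiableAt hY hZ) (g.app_mdifferentiableAt hY hZ'),
      mvfderiv_fun_add (g.app_mdifferentiableAt hZ hX) (g.app_mdifferentiableAt hZ' hX)]
    simp [app, bracket, mlieBracket_add_right hZ hZ', mlieBracket_add_left hZ hZ']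
    ring

theorem existsUnique_koszul {X Y : VField n M} {p : M} (hX : DiffAt X p) (hY : DiffAt Y p) :
    ∃! v : Tan n p, ∀ Z : VField n M, DiffAt Z p →
      2 * g.val p v (Z p) = g.koszul X Y Z p := by
  have T := g.koszul_tensorial hX hY
  obtain ⟨e, he⟩ := g.signature p
  have hs : ∀ j, sgn n j * sgn n j = 1 := fun j ↦ by unfold sgn; split_ifs <;> norm_num
  let β : Tan n p →L[ℝ] ℝ := TensorialAt.mkHom _ p T
  have hv : ∀ Z : VField n M, DiffAt Z p →
      2 * g.val p (∑ i, (2⁻¹ * sgn n i * β (e i)) • e i) (Z p) = g.koszul X Y Z p := by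
    intro Z hZ
    have hβ : β (Z p) = g.koszul X Y Z p := TensorialAt.mkHom_apply T hZ
    rw [← hβ]
    generalize Z p = z
    rw [← e.sum_repr z]
    simp only [map_sum, map_smul, _root_.sum_apply, _root_.smul_apply,
      he _ _, smul_eq_mul, mul_ite, mul_zero, Finset.sum_ite_eq', Finset.mem_univ, if_true,
      Finset.mul_sum]
    refine Finset.sum_congr rfl fun i _ ↦ ?_
    linear_combination (e.repr z i * β (e i)) * hs i
  refine ⟨_, hv, fun w hw ↦ ?_⟩
  rw [← sub_eq_zero]
  refine g.nondegenerate fun z ↦ ?_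
  have hz := FiberBundle.mdifferentiableAt_extend (𝓡 (2 * n + 1)) (Model n) z
  have h1 := hw _ hz
  rw [← TensorialAt.mkHom_apply T hz] at h1
  rw [FiberBundle.extend_apply_self] at h1
  have h2 : 2 * g.val p (∑ i, (2⁻¹ * sgn n i * β (e i)) • e i) z = β z := by
    have h3 := hv _ hz
    rw [← TensorialAt.mkHom_apply T hz, FiberBundle.extend_apply_self] at h3
    exact h3
  rw [map_sub, _root_.sub_apply]
  linarith

open Classical in
/-- The Levi-Civita connection of `g`, characterized by the Koszul formula: for vector fields
`X`, `Y` differentiable at `p`, the value of `∇_X Y` at `p` is the unique tangent vector with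
`2 g(∇_X Y, Z) = X g(Y,Z) + Y g(Z,X) - Z g(X,Y) + g([X,Y],Z) - g([Y,Z],X) + g([Z,X],Y)`
for all vector fields `Z` differentiable at `p` (it exists by `existsUnique_koszul`);
where `X` or `Y` is not differentiable the value is `0` by convention. -/
def nabla (X Y : VField n M) : VField n M := fun p ↦
  if h : DiffAt X p ∧ DiffAt Y p then (g.existsUnique_koszul h.1 h.2).choose else 0

/-- The curvature `R(X,Y)Z = ∇_X ∇_Y Z - ∇_Y ∇_X Z - ∇_[X,Y] Z`, of type `(1,3)`. -/
def curv (X Y Z : VField n M) : VField n M := fun p ↦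
  g.nabla X (g.nabla Y Z) p - g.nabla Y (g.nabla X Z) p - g.nabla (bracket X Y) Z p

/-- The curvature `R(X,Y,Z,U) = g(R(X,Y)Z, U)` of type `(0,4)`. -/
def curv₄ (X Y Z U : VField n M) (p : M) : ℝ := g.val p (g.curv X Y Z p) (U p)

/-- The Ricci tensor `Ric(Y,Z) = ∑ i, ε_i R(e_i, Y, Z, e_i)` at `p`, computed with an orthonormal
basis `e_0, …, e_{2n}` of `T_p M`. The value at `p` of `R(e_i, Y, Z, e_i)` is obtained from
extensions of the vectors `e_i` to local smooth vector fields. -/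
def ricci {p : M} (e : Module.Basis (Fin (2 * n + 1)) ℝ (Tan n p)) (Y Z : VField n M) : ℝ :=
  ∑ i, sgn n i * g.curv₄ (FiberBundle.extend (Model n) (e i)) Y Z
    (FiberBundle.extend (Model n) (e i)) p

end PseudoMetric

variable (n M) in
/-- An almost contact complex Riemannian (almost contact B-metric) structure `(φ, ξ, η, g)` on a
`(2n+1)`-dimensional manifold. -/
structure AlmostContactComplexRiemannian where
  /-- the endomorphism `φ` of the tangent bundle -/
  φ : Π p : M, Tan n p →L[ℝ] Tan n p
  /-- the vector field `ξ` -/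
  ξ : VField n M
  /-- the 1-form `η` -/
  η : Π p : M, Tan n p →L[ℝ] ℝ
  /-- the pseudo-Riemannian metric `g` of signature `(n+1, n)` -/
  g : PseudoMetric n M
  smooth_φ : ContMDiff (𝓡 (2 * n + 1))
    ((𝓡 (2 * n + 1)).prod 𝓘(ℝ, Model n →L[ℝ] Model n)) ∞
    (fun p ↦ Bundle.TotalSpace.mk' (Model n →L[ℝ] Model n)
      (E := fun p : M ↦ Tan n p →L[ℝ] Tan n p) p (φ p))
  smooth_ξ : Smooth ξ
  smooth_η : ContMDiff (𝓡 (2 * n + 1))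
    ((𝓡 (2 * n + 1)).prod 𝓘(ℝ, Model n →L[ℝ] ℝ)) ∞
    (fun p ↦ Bundle.TotalSpace.mk' (Model n →L[ℝ] ℝ)
      (E := fun p : M ↦ Tan n p →L[ℝ] ℝ) p (η p))
  φ_ξ : ∀ p, φ p (ξ p) = 0
  φ_φ : ∀ p (v : Tan n p), φ p (φ p v) = -v + η p v • ξ p
  η_φ : ∀ p (v : Tan n p), η p (φ p v) = 0
  η_ξ : ∀ p, η p (ξ p) = 1
  compat : ∀ p (v w : Tan n p), g.val p (φ p v) (φ p w) = -g.val p v w + η p v * η p w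

namespace AlmostContactComplexRiemannian

variable (S : AlmostContactComplexRiemannian n M)

/-- The vector field `φ X`. -/
def phi (X : VField n M) : VField n M := fun p ↦ S.φ p (X p)

/-- The function `η(X)`. -/
def eta (X : VField n M) (p : M) : ℝ := S.η p (X p)

/-- The vector field `X` is horizontal, i.e. tangent to `H = ker η`. -/
def Horizontal (X : VField n M) : Prop := ∀ p, S.eta X p = 0

/-- The covariant derivative `(∇_X φ) Y = ∇_X (φ Y) - φ (∇_X Y)`. -/
def nablaPhi (X Y : VField n M) : VField n M := fun p ↦
  S.g.nabla X (S.phi Y) p - S.φ p (S.g.nabla X Y p)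

/-- The structure tensor `F(X, Y, Z) = g((∇_X φ) Y, Z)`. -/
def F (X Y Z : VField n M) (p : M) : ℝ := S.g.val p (S.nablaPhi X Y p) (Z p)

/-- The structure is Sasaki-like: for all smooth horizontal vector fields `X`, `Y`, `Z`,
`F(X,Y,Z) = F(ξ,Y,Z) = F(ξ,ξ,Z) = 0` and `F(X,Y,ξ) = -g(X,Y)`. -/
def IsSasakiLike : Prop :=
  ∀ X Y Z : VField n M, Smooth X → Smooth Y → Smooth Z →
    S.Horizontal X → S.Horizontal Y → S.Horizontal Z → ∀ p,
      S.F X Y Z p = 0 ∧ S.F S.ξ Y Z p = 0 ∧ S.F S.ξ S.ξ Z p = 0 ∧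
      S.F X Y S.ξ p = -S.g.app X Y p

end AlmostContactComplexRiemannian

end

end SasakiLike

end

noncomputable section

namespace SasakiLike

open Topology

/-! ### Directional derivatives, brackets and extension of sections. -/

variable {n : ℕ} {M : Type*} [TopologicalSpace M] [ChartedSpace (Model n) M]

/-! Since `∇φ` is a tensor and `φ` is `g`-self-adjoint, the Sasaki-like conditions determine it
completely: `(∇_x φ)y = -g(x,y)ξ - η(y)x + 2η(x)η(y)ξ` (`nablaPhiAt_eq`). Putting `y = ξ` and
applying `φ` gives `∇_x ξ = -φx` (`nabla_ξ`). The main formula is then the Ricci identity for `φ`: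
differentiating the structure equation once more and antisymmetrising computes `R(x,y)φz - φR(x,y)z`
(`curv_phi`), which is paired with `u`. Differentiating `∇ξ = -φ` in the same way gives `R(x,y)ξ`
(`curv_ξ`), and its trace gives `Ric(y,ξ)` (`ricci_ξ`).

As `nabla` is `0` at points where a field is not differentiable, iterating it requires `∇_X Y` to be
differentiable (`diffAt_nabla`). Regularity is assumed only at the point, so that the local
extensions in `ricci` are covered. -/

theorem bracket_swap (X Y : VField n M) (p : M) : bracket X Y p = -bracket Y X p :=
  mlieBracket_swap_apply

theorem dirDeriv_congr {X : VField n M} {f f' : M → ℝ} {p : M} (h : f =ᶠ[𝓝 p] f') :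
    dirDeriv X f p = dirDeriv X f' p := by
  simp only [dirDeriv, mvfderiv, h.mfderiv_eq]
  rfl

theorem dirDeriv_const {X : VField n M} {c : ℝ} {p : M} : dirDeriv X (fun _ ↦ c) p = 0 := by
  rw [dirDeriv, mvfderiv_const]
  rfl

theorem dirDeriv_add {X : VField n M} {f f' : M → ℝ} {p : M}
    (hf : MDifferentiableAt (𝓡 (2 * n + 1)) 𝓘(ℝ, ℝ) f p)
    (hf' : MDifferentiableAt (𝓡 (2 * n + 1)) 𝓘(ℝ, ℝ) f' p) :
    dirDeriv X (fun q ↦ f q + f' q) p = dirDeriv X f p + dirDeriv X f' p := by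
  simp [dirDeriv, mvfderiv_fun_add hf hf']

theorem dirDeriv_neg {X : VField n M} {f : M → ℝ} {p : M} :
    dirDeriv X (fun q ↦ -f q) p = -dirDeriv X f p := by
  simp [dirDeriv, mvfderiv_fun_neg]

theorem dirDeriv_mul {X : VField n M} {f f' : M → ℝ} {p : M}
    (hf : MDifferentiableAt (𝓡 (2 * n + 1)) 𝓘(ℝ, ℝ) f p)
    (hf' : MDifferentiableAt (𝓡 (2 * n + 1)) 𝓘(ℝ, ℝ) f' p) :
    dirDeriv X (fun q ↦ f q * f' q) p = f p * dirDeriv X f' p + f' p * dirDeriv X f p := by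
  simp [dirDeriv, mvfderiv_fun_mul hf hf']

variable [IsManifold (𝓡 (2 * n + 1)) ∞ M]

/-- The vector field `X` is `C^k` at the point `p`. -/
abbrev CAt (k : WithTop ℕ∞) (X : VField n M) (p : M) : Prop :=
  ContMDiffAt (𝓡 (2 * n + 1)) ((𝓡 (2 * n + 1)).prod 𝓘(ℝ, Model n)) k (T% X) p

theorem CAt.eventually_diffAt {k : ℕ} {X : VField n M} {p : M} (hX : CAt k X p) (hk : k ≠ 0) :
    ∀ᶠ q in 𝓝 p, DiffAt X q := by
  filter_upwards [(contMDiffAt_iff_contMDiffAt_nhds (by simp)).1 hX] with q hq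
  exact hq.mdifferentiableAt (by simpa)

theorem contMDiffAt_dirDeriv {X : VField n M} {f : M → ℝ} {p : M}
    (hX : CAt 1 X p)
    (hf : ContMDiffAt (𝓡 (2 * n + 1)) 𝓘(ℝ, ℝ) 2 f p) :
    ContMDiffAt (𝓡 (2 * n + 1)) 𝓘(ℝ, ℝ) 1 (dirDeriv X f) p := by
  have h1 := hf.mfderiv_const (m := 1) (by norm_num)
  have h2 := ContMDiffAt.clm_apply_of_inCoordinates (b₁ := id) (b₂ := f) (v := X)
    (ϕ := fun q ↦ mfderiv (𝓡 (2 * n + 1)) 𝓘(ℝ, ℝ) f q) (E₁ := fun p : M ↦ Tan n p)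
    (E₂ := fun p : ℝ ↦ TangentSpace 𝓘(ℝ, ℝ) p) h1 hX (hf.of_le (by norm_num))
  exact (contMDiff_snd_tangentBundle_modelSpace ℝ 𝓘(ℝ, ℝ)).contMDiffAt.comp p h2

theorem contMDiffAt_bracket {X Y : VField n M} {p : M}
    (hX : CAt 2 X p)
    (hY : CAt 2 Y p) :
    CAt 1 (bracket X Y) p := by
  have : IsManifold (𝓡 (2 * n + 1)) ((2 : ℕ∞) + 1) M :=
    IsManifold.of_le (n := ∞) (by exact_mod_cast le_top)
  have : IsManifold (𝓡 (2 * n + 1)) (minSmoothness ℝ 2) M := by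
    rw [minSmoothness_of_isRCLikeNormedField]
    infer_instance
  exact ContMDiffAt.mlieBracket_vectorField (m := 1) (n := 2) hX hY (by simp; norm_num)

/-- A local extension is cut off by a bump function. Global sections are needed because the
Sasaki-like hypothesis quantifies over globally smooth fields. -/
theorem _root_.Bundle.exists_contMDiff_extension {E : Type*} [NormedAddCommGroup E]
    [NormedSpace ℝ E] {H : Type*} [TopologicalSpace H] {I : ModelWithCorners ℝ E H}
    {M : Type*} [TopologicalSpace M] [ChartedSpace H M] [FiniteDimensional ℝ E] [T2Space M]
    [IsManifold I ∞ M]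
    (F : Type*) [NormedAddCommGroup F] [NormedSpace ℝ F] (V : M → Type*)
    [TopologicalSpace (Bundle.TotalSpace F V)] [∀ x, AddCommGroup (V x)] [∀ x, Module ℝ (V x)]
    [∀ x, TopologicalSpace (V x)] [FiberBundle F V] [VectorBundle ℝ F V]
    [ContMDiffVectorBundle ∞ F V I]
    {p : M} (v : V p) :
    ∃ s : Π x, V x, ContMDiff I (I.prod 𝓘(ℝ, F)) ∞ (T% s) ∧ s p = v := by
  obtain ⟨u, hu, hs⟩ := FiberBundle.exists_contMDiffOn_extend I F v (k := ∞)
  obtain ⟨f, -, hf⟩ :=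
    (SmoothBumpFunction.nhds_basis_tsupport (I := I) p).mem_iff.1 (interior_mem_nhds.2 hu)
  exact ⟨(f : M → ℝ) • FiberBundle.extend F v, f.contMDiff.contMDiffOn.smul_section_of_tsupport
    isOpen_interior hf (hs.mono interior_subset), by simp⟩

/-! ### The Levi-Civita connection and its regularity. -/

namespace PseudoMetric

variable (g : PseudoMetric n M) {X Y Z : VField n M} {p : M} {f : M → ℝ}

theorem app_comm (X Y : VField n M) : g.app X Y = g.app Y X := by
  ext q; exact g.symm q _ _

theorem two_mul_val_nabla (hX : DiffAt X p) (hY : DiffAt Y p) (hZ : DiffAt Z p) :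
    2 * g.val p (g.nabla X Y p) (Z p) = g.koszul X Y Z p := by
  have h : DiffAt X p ∧ DiffAt Y p := ⟨hX, hY⟩
  simp only [nabla, dif_pos h]
  exact (g.existsUnique_koszul hX hY).choose_spec.1 Z hZ

/-- Two tangent vectors agree if they have the same products with all differentiable fields. -/
theorem ext_fields {v w : Tan n p}
    (h : ∀ Z : VField n M, DiffAt Z p → g.val p v (Z p) = g.val p w (Z p)) : v = w := by
  rw [← sub_eq_zero]
  refine g.nondegenerate fun z ↦ ?_
  have hz := h _ (FiberBundle.mdifferentiableAt_extend (𝓡 (2 * n + 1)) (Model n) z)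
  rw [FiberBundle.extend_apply_self] at hz
  rw [map_sub, _root_.sub_apply, hz, sub_self]

theorem ext_val {v w : Tan n p} (h : ∀ z, g.val p v z = g.val p w z) : v = w :=
  g.ext_fields fun _ _ ↦ h _

/-- The Levi-Civita connection is metric. -/
theorem dirDeriv_app (hX : DiffAt X p) (hY : DiffAt Y p) (hZ : DiffAt Z p) :
    dirDeriv X (g.app Y Z) p =
      g.val p (g.nabla X Y p) (Z p) + g.val p (Y p) (g.nabla X Z p) := by
  have h1 := g.two_mul_val_nabla hX hY hZ
  have h2 := g.two_mul_val_nabla hX hZ hY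
  rw [g.symm p (Y p)]
  simp only [koszul, g.app_comm Z X, g.app_comm Y X, g.app_comm Z Y] at h1 h2
  simp only [app, bracket_swap Z Y p, bracket_swap Y X p, bracket_swap Z X p,
    map_neg, _root_.neg_apply] at h1 h2 ⊢
  linarith

/-- The Levi-Civita connection is torsion-free. -/
theorem nabla_sub_nabla (hX : DiffAt X p) (hY : DiffAt Y p) :
    g.nabla X Y p - g.nabla Y X p = bracket X Y p := by
  refine g.ext_fields fun Z hZ ↦ ?_
  have h1 := g.two_mul_val_nabla hX hY hZ
  have h2 := g.two_mul_val_nabla hY hX hZ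
  simp only [koszul, g.app_comm Z X, g.app_comm Y X, g.app_comm Z Y] at h1 h2
  simp only [app, bracket_swap Z Y p, bracket_swap Y X p, bracket_swap Z X p,
    map_neg, _root_.neg_apply, map_sub, _root_.sub_apply] at h1 h2 ⊢
  linarith

/-- Locality in the differentiated field: explicit formulas for `∇_Y Z` hold only near `p`, yet must
be differentiated again at `p`. -/
theorem nabla_congr {Y' : VField n M} (h : Y =ᶠ[𝓝 p] Y') (hX : DiffAt X p) (hY : DiffAt Y p) :
    g.nabla X Y p = g.nabla X Y' p := by
  have h0 : (T% Y') =ᶠ[𝓝 p] (T% Y) := by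
    filter_upwards [h] with q hq
    simp [hq]
  have hY' : DiffAt Y' p := hY.congr_of_eventuallyEq h0
  refine g.ext_fields fun Z hZ ↦ ?_
  have h1 := g.two_mul_val_nabla hX hY hZ
  have h2 := g.two_mul_val_nabla hX hY' hZ
  have e1 : dirDeriv X (g.app Y Z) p = dirDeriv X (g.app Y' Z) p :=
    dirDeriv_congr (by filter_upwards [h] with q hq; simp [app, hq])
  have e2 : dirDeriv Z (g.app X Y) p = dirDeriv Z (g.app X Y') p :=
    dirDeriv_congr (by filter_upwards [h] with q hq; simp [app, hq])
  have e3 : bracket X Y p = bracket X Y' p :=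
    Filter.EventuallyEq.mlieBracket_vectorField_eq .rfl h
  have e4 : bracket Y Z p = bracket Y' Z p :=
    Filter.EventuallyEq.mlieBracket_vectorField_eq h .rfl
  have e5 : dirDeriv Y (g.app Z X) p = dirDeriv Y' (g.app Z X) p := by
    simp [dirDeriv, h.eq_of_nhds]
  simp only [koszul, app, ← e1, ← e2, ← e3, ← e4, ← e5, ← h.eq_of_nhds] at h1 h2
  linarith

/-- In `X g(Y,Z) = g(∇_X Y,Z) + g(Y,∇_X Z)` every term but the first on the right is visibly
additive in `Y`. -/
theorem nabla_add {Y' : VField n M} (hX : DiffAt X p) (hY : DiffAt Y p) (hY' : DiffAt Y' p) :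
    g.nabla X (Y + Y') p = g.nabla X Y p + g.nabla X Y' p := by
  have hs : DiffAt (Y + Y') p := mdifferentiableAt_add_section hY hY'
  refine g.ext_fields fun Z hZ ↦ ?_
  have h := g.dirDeriv_app hX hs hZ
  have h1 := g.dirDeriv_app hX hY hZ
  have h2 := g.dirDeriv_app hX hY' hZ
  have e : g.app (Y + Y') Z = fun q ↦ g.app Y Z q + g.app Y' Z q := by ext; simp [app]
  rw [e, dirDeriv_add (g.app_mdifferentiableAt hY hZ) (g.app_mdifferentiableAt hY' hZ)] at h
  simp only [Pi.add_apply, map_add, _root_.add_apply] at h ⊢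
  linarith

theorem nabla_smul (hf : MDifferentiableAt (𝓡 (2 * n + 1)) 𝓘(ℝ, ℝ) f p)
    (hX : DiffAt X p) (hY : DiffAt Y p) :
    g.nabla X (f • Y) p = f p • g.nabla X Y p + dirDeriv X f p • Y p := by
  have hs : DiffAt (f • Y) p := hf.smul_section hY
  refine g.ext_fields fun Z hZ ↦ ?_
  have h := g.dirDeriv_app hX hs hZ
  have h1 := g.dirDeriv_app hX hY hZ
  have e : g.app (f • Y) Z = fun q ↦ f q * g.app Y Z q := by ext; simp [app]
  rw [e, dirDeriv_mul hf (g.app_mdifferentiableAt hY hZ)] at h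
  simp only [Pi.smul_apply', map_smul, _root_.smul_apply, map_add, _root_.add_apply,
    smul_eq_mul, app] at h ⊢
  linear_combination f p * h1 - h

/-- Vanishing torsion transfers linearity from the second argument to the first. -/
theorem nabla_add_left {X' : VField n M} (hX : DiffAt X p) (hX' : DiffAt X' p)
    (hY : DiffAt Y p) :
    g.nabla (X + X') Y p = g.nabla X Y p + g.nabla X' Y p := by
  have hs : DiffAt (X + X') p := mdifferentiableAt_add_section hX hX'
  have e : bracket (X + X') Y p = bracket X Y p + bracket X' Y p :=
    mlieBracket_add_left hX hX'
  rw [← g.nabla_sub_nabla hs hY, ← g.nabla_sub_nabla hX hY, ← g.nabla_sub_nabla hX' hY,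
    g.nabla_add hY hX hX'] at e
  rw [sub_eq_iff_eq_add] at e
  rw [e]
  abel

theorem nabla_smul_left (hf : MDifferentiableAt (𝓡 (2 * n + 1)) 𝓘(ℝ, ℝ) f p)
    (hX : DiffAt X p) (hY : DiffAt Y p) :
    g.nabla (f • X) Y p = f p • g.nabla X Y p := by
  have hs : DiffAt (f • X) p := hf.smul_section hX
  have e : bracket (f • X) Y p = -dirDeriv Y f p • X p + f p • bracket X Y p :=
    mlieBracket_smul_left hf hX
  rw [← g.nabla_sub_nabla hs hY, ← g.nabla_sub_nabla hX hY,
    g.nabla_smul hf hY hX, sub_eq_iff_eq_add] at e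
  rw [e]
  module

theorem contMDiffAt_app {k : WithTop ℕ∞} (hk : k ≤ ∞) (hX : CAt k X p) (hY : CAt k Y p) :
    ContMDiffAt (𝓡 (2 * n + 1)) 𝓘(ℝ, ℝ) k (g.app X Y) p := by
  have : ContMDiffAt (𝓡 (2 * n + 1)) ((𝓡 (2 * n + 1)).prod 𝓘(ℝ, ℝ)) k
      (fun m ↦ Bundle.TotalSpace.mk' ℝ (E := Bundle.Trivial M ℝ) m (g.val m (X m) (Y m))) p := by
    apply ContMDiffAt.clm_bundle_apply₂ (F₁ := Model n) (F₂ := Model n)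
    · exact g.contMDiff.contMDiffAt.of_le hk
    · exact hX
    · exact hY
  rw [Bundle.contMDiffAt_totalSpace] at this
  exact this.2

theorem contMDiffAt_koszul (hX : CAt 2 X p) (hY : CAt 2 Y p) (hZ : CAt 2 Z p) :
    ContMDiffAt (𝓡 (2 * n + 1)) 𝓘(ℝ, ℝ) 1 (g.koszul X Y Z) p := by
  have h2 : (2 : WithTop ℕ∞) ≤ ∞ := ENat.LEInfty.out
  have h12 : (1 : WithTop ℕ∞) ≤ 2 := by norm_num
  have h1 := h12.trans h2
  have hX1 := hX.of_le h12
  have hY1 := hY.of_le h12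
  have hZ1 := hZ.of_le h12
  exact (((((contMDiffAt_dirDeriv hX1 (g.contMDiffAt_app h2 hY hZ)).add
    (contMDiffAt_dirDeriv hY1 (g.contMDiffAt_app h2 hZ hX))).sub
    (contMDiffAt_dirDeriv hZ1 (g.contMDiffAt_app h2 hX hY))).add
    (g.contMDiffAt_app h1 (contMDiffAt_bracket hX hY) hZ1)).sub
    (g.contMDiffAt_app h1 (contMDiffAt_bracket hY hZ) hX1)).add
    (g.contMDiffAt_app h1 (contMDiffAt_bracket hZ hX) hY1)

/-- A vector field whose products with all `C^2` vector fields are differentiable is itself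
differentiable. -/
theorem diffAt_of_app {W : VField n M}
    (h : ∀ Z : VField n M, CAt 2 Z p → MDifferentiableAt (𝓡 (2 * n + 1)) 𝓘(ℝ, ℝ) (g.app W Z) p) :
    DiffAt W p := by
  let t := trivializationAt (Model n) (fun q : M ↦ Tan n q) p
  have hp : p ∈ t.baseSet := FiberBundle.mem_baseSet_trivializationAt' p
  let b := (EuclideanSpace.basisFun (Fin (2 * n + 1)) ℝ).toBasis
  let E : Fin (2 * n + 1) → VField n M := t.localFrame b
  let c : M → Fin (2 * n + 1) → ℝ := fun q i ↦ t.localFrameCoeff (𝓡 (2 * n + 1)) b i q (W q)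
  have hE : ∀ i, CAt 2 (E i) p := fun i ↦ contMDiffAt_localFrame_of_mem 2 _ b i hp
  have hE1 : ∀ i, DiffAt (E i) p := fun i ↦ (hE i).mdifferentiableAt (by norm_num)
  -- The Gram matrix of a local frame; inverting it recovers the coefficients of `W` from the
  -- products `g(W, E_j)`.
  let A : M → (Fin (2 * n + 1) → ℝ) →L[ℝ] (Fin (2 * n + 1) → ℝ) := fun q ↦
    ∑ i, ∑ j, g.app (E i) (E j) q •
      (ContinuousLinearMap.proj (R := ℝ) (φ := fun _ : Fin (2 * n + 1) ↦ ℝ) i).smulRight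
        (Pi.single j (1 : ℝ))
  have hA_apply : ∀ q v j, A q v j = g.val q (∑ i, v i • E i q) (E j q) := by
    intro q v j
    simp [A, app, Finset.sum_apply, Pi.single_apply, mul_comm]
  have hA : MDifferentiableAt (𝓡 (2 * n + 1))
      𝓘(ℝ, (Fin (2 * n + 1) → ℝ) →L[ℝ] (Fin (2 * n + 1) → ℝ)) A p := by
    have : A = ∑ i, ∑ j, fun q ↦ g.app (E i) (E j) q •
      (ContinuousLinearMap.proj (R := ℝ) (φ := fun _ : Fin (2 * n + 1) ↦ ℝ) i).smulRight
        (Pi.single j (1 : ℝ)) := by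
      ext1 q
      simp only [A, Finset.sum_apply]
    rw [this]
    exact .sum fun i _ ↦ .sum fun j _ ↦
      (g.app_mdifferentiableAt (hE1 i) (hE1 j)).smul mdifferentiableAt_const
  -- A kernel vector gives a combination of the frame orthogonal to the whole frame, hence zero by
  -- nondegeneracy.
  have hAinv : ∀ q ∈ t.baseSet, (A q).IsInvertible := by
    intro q hq
    have hinj : Function.Injective (A q : (Fin (2 * n + 1) → ℝ) →ₗ[ℝ] (Fin (2 * n + 1) → ℝ)) := by
      rw [← LinearMap.ker_eq_bot, LinearMap.ker_eq_bot']
      intro v hv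
      have h0 : ∑ i, v i • E i q = 0 := by
        refine g.nondegenerate fun w ↦ ?_
        rw [← (t.basisAt b hq).sum_repr w, map_sum]
        refine Finset.sum_eq_zero fun j _ ↦ ?_
        have := congrFun hv j
        rw [ContinuousLinearMap.coe_coe, hA_apply] at this
        rw [map_smul, ← t.localFrame_apply_of_mem_baseSet b hq, this]
        simp
      have hli := (t.basisAt b hq).linearIndependent
      rw [Fintype.linearIndependent_iff] at hli
      ext i
      refine hli v ?_ i
      simpa only [E, t.localFrame_apply_of_mem_baseSet b hq] using h0
    exact ⟨(LinearEquiv.ofInjectiveEndo _ hinj).toContinuousLinearEquiv, by ext; rfl⟩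
  have hev : c =ᶠ[𝓝 p] fun q ↦ (A q).inverse (∑ j, g.app W (E j) q • Pi.single j (1 : ℝ)) := by
    filter_upwards [t.open_baseSet.mem_nhds hp] with q hq
    refine ((hAinv q hq).inverse_apply_eq.2 ?_).symm
    ext j
    rw [hA_apply, ← t.eq_sum_localFrameCoeff_smul hq (s := W)]
    simp [app, Finset.sum_apply, Pi.single_apply]
  have hc : MDifferentiableAt (𝓡 (2 * n + 1)) 𝓘(ℝ, Fin (2 * n + 1) → ℝ) c p := by
    refine MDifferentiableAt.congr_of_eventuallyEq ?_ hev
    refine MDifferentiableAt.clm_apply (g := fun q ↦ (A q).inverse) ?_ ?_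
    · exact ((hAinv p hp).contDiffAt_map_inverse (n := 1)).differentiableAt one_ne_zero
        |>.comp_mdifferentiableAt hA
    · have : (fun q ↦ ∑ j, g.app W (E j) q • (Pi.single j (1 : ℝ) : Fin (2 * n + 1) → ℝ)) =
          ∑ j, fun q ↦ g.app W (E j) q • (Pi.single j (1 : ℝ) : Fin (2 * n + 1) → ℝ) := by
        ext1 q
        simp only [Finset.sum_apply]
      rw [this]
      exact .sum fun j _ ↦ (h _ (hE j)).smul mdifferentiableAt_const
  refine (mdifferentiableAt_iff_localFrameCoeff b hp).2 fun i ↦ ?_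
  exact (ContinuousLinearMap.proj (R := ℝ) (φ := fun _ : Fin (2 * n + 1) ↦ ℝ) i).differentiableAt
    |>.comp_mdifferentiableAt hc

/-- The products of `∇_X Y` with `C^2` fields are half the Koszul expression, which is `C^1`. -/
theorem diffAt_nabla (hX : CAt 2 X p) (hY : CAt 2 Y p) : DiffAt (g.nabla X Y) p := by
  refine g.diffAt_of_app fun Z hZ ↦ ?_
  have h := (contMDiffAt_const (c := (2⁻¹ : ℝ))).mul (g.contMDiffAt_koszul hX hY hZ)
  refine (h.mdifferentiableAt one_ne_zero).congr_of_eventuallyEq ?_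
  filter_upwards [CAt.eventually_diffAt hX two_ne_zero, CAt.eventually_diffAt hY two_ne_zero,
    CAt.eventually_diffAt hZ two_ne_zero] with q hXq hYq hZq
  rw [Pi.mul_apply, ← g.two_mul_val_nabla hXq hYq hZq, app]
  ring

end PseudoMetric

/-! ### Algebra of the structure and the tensor `∇φ`. -/

namespace AlmostContactComplexRiemannian

variable (S : AlmostContactComplexRiemannian n M) {X Y Z : VField n M} {p : M}

/-- Compatibility for `φv` and `w`, with `φ²` expanded; the extra term `g(ξ,φw)` vanishes by
compatibility for `ξ` and `φw`. -/
theorem val_φ (v w : Tan n p) : S.g.val p (S.φ p v) w = S.g.val p v (S.φ p w) := by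
  have h1 := S.compat p (S.φ p v) w
  have h2 := S.compat p v (S.ξ p)
  have h3 := S.compat p (S.ξ p) (S.φ p w)
  simp only [S.φ_φ, S.φ_ξ, S.η_φ, S.η_ξ, map_add, map_neg, map_smul, map_zero, _root_.add_apply,
    _root_.neg_apply, _root_.smul_apply, smul_eq_mul, _root_.zero_apply] at h1 h2 h3
  linear_combination h1 - S.η p v * h3

theorem val_ξ (v : Tan n p) : S.g.val p v (S.ξ p) = S.η p v := by
  have h2 := S.compat p v (S.ξ p)
  simp only [S.φ_ξ, S.η_ξ, map_zero] at h2
  linarith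

theorem ξ_val (v : Tan n p) : S.g.val p (S.ξ p) v = S.η p v := by
  rw [S.g.symm, S.val_ξ]

theorem eta_eq_app (X : VField n M) : S.eta X = S.g.app X S.ξ := by
  ext q; exact (S.val_ξ _).symm

theorem diffAt_ξ : DiffAt S.ξ p := S.smooth_ξ.contMDiffAt.mdifferentiableAt (by simp)

theorem mdifferentiableAt_eta (hX : DiffAt X p) :
    MDifferentiableAt (𝓡 (2 * n + 1)) 𝓘(ℝ, ℝ) (S.eta X) p := by
  rw [eta_eq_app]
  exact S.g.app_mdifferentiableAt hX S.diffAt_ξ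

theorem diffAt_phi (hX : DiffAt X p) : DiffAt (S.phi X) p :=
  MDifferentiableAt.clm_bundle_apply (F₁ := Model n) (F₂ := Model n)
    (S.smooth_φ.contMDiffAt.mdifferentiableAt (by simp)) hX

theorem cAt_phi {k : WithTop ℕ∞} (hk : k ≤ ∞) (hX : CAt k X p) : CAt k (S.phi X) p :=
  ContMDiffAt.clm_bundle_apply (F₁ := Model n) (F₂ := Model n)
    (S.smooth_φ.contMDiffAt.of_le hk) hX

theorem exists_smooth_horizontal [T2Space M] {v : Tan n p} (hv : S.η p v = 0) :
    ∃ X : VField n M, Smooth X ∧ S.Horizontal X ∧ X p = v := by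
  obtain ⟨X, hX, rfl⟩ := Bundle.exists_contMDiff_extension (I := 𝓡 (2 * n + 1)) (Model n)
    (fun p : M ↦ Tan n p) v
  have hη : ContMDiff (𝓡 (2 * n + 1)) 𝓘(ℝ, ℝ) ∞ (S.eta X) := fun q ↦ by
    rw [eta_eq_app]
    exact S.g.contMDiffAt_app le_rfl (hX q) (S.smooth_ξ q)
  refine ⟨X - S.eta X • S.ξ, hX.sub_section (hη.smul_section S.smooth_ξ), fun q ↦ ?_, ?_⟩
  · simp [eta, S.η_ξ]
  · simp [eta, hv]

theorem nablaPhi_tensorial_right (hX : DiffAt X p) :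
    TensorialAt (𝓡 (2 * n + 1)) (Model n) (fun Y : VField n M ↦ S.nablaPhi X Y p) p where
  smul {f Y} hf hY := by
    have e : S.phi (f • Y) = f • S.phi Y := by ext1 q; simp [phi]
    simp only [nablaPhi, e, S.g.nabla_smul hf hX hY, S.g.nabla_smul hf hX (S.diffAt_phi hY),
      map_add, map_smul, phi]
    module
  add {Y Y'} hY hY' := by
    have e : S.phi (Y + Y') = S.phi Y + S.phi Y' := by ext1 q; simp [phi]
    simp only [nablaPhi, e, S.g.nabla_add hX hY hY',
      S.g.nabla_add hX (S.diffAt_phi hY) (S.diffAt_phi hY'), map_add]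
    abel

theorem nablaPhi_tensorial_left (hY : DiffAt Y p) :
    TensorialAt (𝓡 (2 * n + 1)) (Model n) (fun X : VField n M ↦ S.nablaPhi X Y p) p where
  smul {f X} hf hX := by
    simp only [nablaPhi, S.g.nabla_smul_left hf hX hY,
      S.g.nabla_smul_left hf hX (S.diffAt_phi hY), map_smul, smul_sub]
  add {X X'} hX hX' := by
    simp only [nablaPhi, S.g.nabla_add_left hX hX' hY,
      S.g.nabla_add_left hX hX' (S.diffAt_phi hY), map_add]
    abel

/-- The tensor `(∇φ)` at the point `p`. -/
def nablaPhiAt (p : M) : Tan n p →L[ℝ] Tan n p →L[ℝ] Tan n p :=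
  TensorialAt.mkHom₂ (fun X Y : VField n M ↦ S.nablaPhi X Y p) p
    (fun _ h ↦ S.nablaPhi_tensorial_left h) (fun _ h ↦ S.nablaPhi_tensorial_right h)

theorem nablaPhiAt_apply (hX : DiffAt X p) (hY : DiffAt Y p) :
    S.nablaPhiAt p (X p) (Y p) = S.nablaPhi X Y p :=
  TensorialAt.mkHom₂_apply (fun _ h ↦ S.nablaPhi_tensorial_left h)
    (fun _ h ↦ S.nablaPhi_tensorial_right h) hX hY

/-- The covariant derivative of a self-adjoint endomorphism field is self-adjoint: differentiate
`g(φY,Z) = g(Y,φZ)`. -/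
theorem val_nablaPhiAt_comm (v w z : Tan n p) :
    S.g.val p (S.nablaPhiAt p v w) z = S.g.val p (S.nablaPhiAt p v z) w := by
  have ext : ∀ v : Tan n p, ∃ X : VField n M, DiffAt X p ∧ X p = v := fun v ↦
    ⟨_, FiberBundle.mdifferentiableAt_extend (𝓡 (2 * n + 1)) (Model n) v,
      FiberBundle.extend_apply_self _ v⟩
  obtain ⟨X, hX, rfl⟩ := ext v
  obtain ⟨Y, hY, rfl⟩ := ext w
  obtain ⟨Z, hZ, rfl⟩ := ext z
  rw [S.nablaPhiAt_apply hX hY, S.nablaPhiAt_apply hX hZ]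
  have h1 := S.g.dirDeriv_app hX (S.diffAt_phi hY) hZ
  have h2 := S.g.dirDeriv_app hX hY (S.diffAt_phi hZ)
  have e : S.g.app (S.phi Y) Z = S.g.app Y (S.phi Z) := by ext q; exact S.val_φ _ _
  rw [e, h2] at h1
  simp only [nablaPhi, map_sub, _root_.sub_apply, S.val_φ]
  simp only [phi] at h1 ⊢
  rw [S.g.symm p (S.g.nabla X Z p), ← S.val_φ]
  rw [S.g.symm p (S.g.nabla X _ p) (Y p), S.val_φ]
  linarith

theorem nabla_zero_right (hX : DiffAt X p) : S.g.nabla X (fun _ ↦ 0) p = 0 := by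
  have h := S.g.nabla_smul (f := fun _ ↦ 0) (Y := S.ξ) mdifferentiableAt_const hX S.diffAt_ξ
  rw [dirDeriv_const, zero_smul, zero_smul, add_zero] at h
  rw [← h]
  congr 1
  ext1 q
  simp

theorem nablaPhi_ξ (hX : DiffAt X p) : S.nablaPhi X S.ξ p = -S.φ p (S.g.nabla X S.ξ p) := by
  have e : S.phi S.ξ = fun _ ↦ 0 := by ext1 q; exact S.φ_ξ q
  rw [nablaPhi, e, S.nabla_zero_right hX, zero_sub]

/-- `(∇_v φ)ξ = -φ(∇_v ξ)` lies in the image of `φ`. This supplies the components `F(·,ξ,ξ)`, which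
the Sasaki-like conditions do not list. -/
theorem η_nablaPhiAt_ξ (v : Tan n p) : S.η p (S.nablaPhiAt p v (S.ξ p)) = 0 := by
  have hX := FiberBundle.mdifferentiableAt_extend (𝓡 (2 * n + 1)) (Model n) v
  have h := S.nablaPhiAt_apply hX S.diffAt_ξ
  rw [FiberBundle.extend_apply_self, S.nablaPhi_ξ hX] at h
  rw [h, map_neg, S.η_φ, neg_zero]

theorem η_sub_smul_ξ (v : Tan n p) : S.η p (v - S.η p v • S.ξ p) = 0 := by
  simp [S.η_ξ]

theorem eq_of_val_horizontal {v w : Tan n p}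
    (h : ∀ z, S.η p z = 0 → S.g.val p v z = S.g.val p w z) (h' : S.η p v = S.η p w) : v = w := by
  refine S.g.ext_val fun z ↦ ?_
  have h1 := h _ (S.η_sub_smul_ξ z)
  simp only [map_sub, map_smul, S.val_ξ, h'] at h1
  exact sub_left_injective h1

/-! ### The Sasaki-like structure equation and its first consequences. -/

variable {S} [T2Space M]

/-- The defining identities of a Sasaki-like structure, at a point. -/
theorem IsSasakiLike.val_nablaPhiAt (hS : S.IsSasakiLike) {v w z : Tan n p} (hv : S.η p v = 0)
    (hw : S.η p w = 0) (hz : S.η p z = 0) :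
    S.g.val p (S.nablaPhiAt p v w) z = 0 ∧ S.g.val p (S.nablaPhiAt p (S.ξ p) w) z = 0 ∧
      S.g.val p (S.nablaPhiAt p (S.ξ p) (S.ξ p)) z = 0 ∧
      S.η p (S.nablaPhiAt p v w) = -S.g.val p v w := by
  obtain ⟨X, hX, hXh, rfl⟩ := S.exists_smooth_horizontal hv
  obtain ⟨Y, hY, hYh, rfl⟩ := S.exists_smooth_horizontal hw
  obtain ⟨Z, hZ, hZh, rfl⟩ := S.exists_smooth_horizontal hz
  have dX : DiffAt X p := hX.contMDiffAt.mdifferentiableAt (by simp)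
  have dY : DiffAt Y p := hY.contMDiffAt.mdifferentiableAt (by simp)
  have h := hS X Y Z hX hY hZ hXh hYh hZh p
  rwa [F, F, F, F, S.val_ξ, ← S.nablaPhiAt_apply dX dY, ← S.nablaPhiAt_apply S.diffAt_ξ dY,
    ← S.nablaPhiAt_apply S.diffAt_ξ S.diffAt_ξ] at h

theorem IsSasakiLike.nablaPhiAt_horizontal (hS : S.IsSasakiLike) {v w : Tan n p}
    (hv : S.η p v = 0) (hw : S.η p w = 0) :
    S.nablaPhiAt p v w = -S.g.val p v w • S.ξ p := by
  refine S.eq_of_val_horizontal (fun z hz ↦ ?_) ?_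
  · simp [(hS.val_nablaPhiAt hv hw hz).1, S.ξ_val, hz]
  · simp [(hS.val_nablaPhiAt hv hw hw).2.2.2, S.η_ξ]

theorem IsSasakiLike.nablaPhiAt_ξ_ξ (hS : S.IsSasakiLike) :
    S.nablaPhiAt p (S.ξ p) (S.ξ p) = 0 := by
  refine S.eq_of_val_horizontal (fun z hz ↦ ?_) ?_
  · simp [(hS.val_nablaPhiAt hz hz hz).2.2.1]
  · simp [S.η_nablaPhiAt_ξ]

/-- The unlisted component `F(ξ,w,ξ)` equals `F(ξ,ξ,w)` by self-adjointness. -/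
theorem IsSasakiLike.nablaPhiAt_ξ_left (hS : S.IsSasakiLike) {w : Tan n p} (hw : S.η p w = 0) :
    S.nablaPhiAt p (S.ξ p) w = 0 := by
  refine S.eq_of_val_horizontal (fun z hz ↦ ?_) ?_
  · simp [(hS.val_nablaPhiAt hw hw hz).2.1]
  · rw [← S.val_ξ, S.val_nablaPhiAt_comm, hS.nablaPhiAt_ξ_ξ]
    simp

theorem IsSasakiLike.nablaPhiAt_ξ_right (hS : S.IsSasakiLike) {v : Tan n p} (hv : S.η p v = 0) :
    S.nablaPhiAt p v (S.ξ p) = -v := by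
  refine S.eq_of_val_horizontal (fun z hz ↦ ?_) ?_
  · rw [S.val_nablaPhiAt_comm, hS.nablaPhiAt_horizontal hv hz]
    simp [S.ξ_val, S.η_ξ]
  · rw [S.η_nablaPhiAt_ξ, map_neg, hv, neg_zero]

theorem IsSasakiLike.nablaPhiAt_eq (hS : S.IsSasakiLike) (v w : Tan n p) :
    S.nablaPhiAt p v w =
      -S.g.val p v w • S.ξ p - S.η p w • v + (2 * S.η p v * S.η p w) • S.ξ p := by
  have hv := S.η_sub_smul_ξ v
  have hw := S.η_sub_smul_ξ w
  have e : S.nablaPhiAt p v w =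
      S.nablaPhiAt p (v - S.η p v • S.ξ p + S.η p v • S.ξ p)
        (w - S.η p w • S.ξ p + S.η p w • S.ξ p) := by simp
  rw [e]
  simp only [map_add, map_smul, _root_.add_apply, _root_.smul_apply,
    hS.nablaPhiAt_horizontal hv hw, hS.nablaPhiAt_ξ_right hv, hS.nablaPhiAt_ξ_left hw,
    hS.nablaPhiAt_ξ_ξ]
  simp only [map_sub, map_smul, _root_.sub_apply, _root_.smul_apply, S.val_ξ, S.ξ_val, S.η_ξ,
    smul_eq_mul]
  module

theorem IsSasakiLike.nabla_phi (hS : S.IsSasakiLike) (hX : DiffAt X p) (hY : DiffAt Y p) :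
    S.g.nabla X (S.phi Y) p = S.φ p (S.g.nabla X Y p) - S.g.app X Y p • S.ξ p
      - S.eta Y p • X p + (2 * S.eta X p * S.eta Y p) • S.ξ p := by
  have h := S.nablaPhiAt_apply hX hY
  rw [hS.nablaPhiAt_eq, nablaPhi, eq_sub_iff_add_eq] at h
  rw [← h]
  simp only [eta, PseudoMetric.app]
  module

/-- The structure equation reads `-φ(∇_X ξ) = -X + η(X)ξ`. Applying `φ` recovers `∇_X ξ`, because it
is horizontal: `g(ξ,ξ) = 1` is constant. -/
theorem IsSasakiLike.nabla_ξ (hS : S.IsSasakiLike) (hX : DiffAt X p) :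
    S.g.nabla X S.ξ p = -S.φ p (X p) := by
  have h := S.nablaPhiAt_apply hX S.diffAt_ξ
  rw [hS.nablaPhiAt_eq, S.nablaPhi_ξ hX] at h
  have h1 := congrArg (S.φ p) h
  have h2 := S.g.dirDeriv_app hX S.diffAt_ξ S.diffAt_ξ
  have e : S.g.app S.ξ S.ξ = fun _ ↦ 1 := by
    ext q; rw [← eta_eq_app, eta, S.η_ξ]
  rw [e, dirDeriv_const, S.val_ξ, S.ξ_val] at h2
  have h3 : S.η p (S.g.nabla X S.ξ p) = 0 := by linarith
  simp only [map_add, map_sub, map_neg, map_smul, S.φ_ξ, S.φ_φ, S.η_ξ, h3, smul_zero, one_smul,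
    zero_smul, add_zero, zero_sub, neg_neg] at h1
  exact h1.symm

theorem IsSasakiLike.dirDeriv_eta (hS : S.IsSasakiLike) (hX : DiffAt X p) (hY : DiffAt Y p) :
    dirDeriv X (S.eta Y) p = S.η p (S.g.nabla X Y p) - S.g.app X (S.phi Y) p := by
  rw [eta_eq_app, S.g.dirDeriv_app hX hY S.diffAt_ξ, hS.nabla_ξ hX, S.val_ξ, map_neg,
    S.g.symm p (Y p), S.val_φ]
  rfl

/-! ### Curvature identities. -/

/-- Vanishing torsion reduces `R(X,Y)ξ` to `(∇_Y φ)X - (∇_X φ)Y`, where the symmetric terms of the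
structure equation cancel. -/
theorem IsSasakiLike.curv_ξ (hS : S.IsSasakiLike) (hX : CAt 2 X p) (hY : CAt 2 Y p) :
    S.g.curv X Y S.ξ p = S.eta Y p • X p - S.eta X p • Y p := by
  have dX := hX.mdifferentiableAt two_ne_zero
  have dY := hY.mdifferentiableAt two_ne_zero
  have key : ∀ X Y : VField n M, CAt 2 X p → CAt 2 Y p →
      S.g.nabla X (S.g.nabla Y S.ξ) p = -S.g.nabla X (S.phi Y) p := by
    intro X Y hX hY
    have dX := hX.mdifferentiableAt two_ne_zero
    have dY := hY.mdifferentiableAt two_ne_zero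
    have ev : S.g.nabla Y S.ξ =ᶠ[𝓝 p] (fun _ : M ↦ (-1 : ℝ)) • S.phi Y := by
      filter_upwards [CAt.eventually_diffAt hY two_ne_zero] with q hq
      rw [hS.nabla_ξ hq, Pi.smul_apply', neg_one_smul]
      rfl
    rw [S.g.nabla_congr ev dX (S.g.diffAt_nabla hY (S.smooth_ξ.contMDiffAt.of_le
      ENat.LEInfty.out)), S.g.nabla_smul mdifferentiableAt_const dX (S.diffAt_phi dY),
      dirDeriv_const]
    simp
  have dB := (contMDiffAt_bracket hX hY).mdifferentiableAt one_ne_zero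
  rw [PseudoMetric.curv, key X Y hX hY, key Y X hY hX, hS.nabla_ξ dB, hS.nabla_phi dX dY,
    hS.nabla_phi dY dX, ← S.g.nabla_sub_nabla dX dY, map_sub, S.g.app_comm Y X]
  module

/-- The second covariant derivative of `φ Z`. -/
theorem IsSasakiLike.nabla_nabla_phi (hS : S.IsSasakiLike) (hX : CAt 2 X p) (hY : CAt 2 Y p)
    (hZ : CAt 2 Z p) :
    S.g.nabla X (S.g.nabla Y (S.phi Z)) p =
      S.φ p (S.g.nabla X (S.g.nabla Y Z) p) - S.g.app X (S.g.nabla Y Z) p • S.ξ p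
      - S.eta (S.g.nabla Y Z) p • X p + (2 * S.eta X p * S.eta (S.g.nabla Y Z) p) • S.ξ p
      + (2 * S.eta Y p * S.eta Z p - S.g.app Y Z p) • (-S.φ p (X p))
      + (2 * (dirDeriv X (S.eta Y) p * S.eta Z p + S.eta Y p * dirDeriv X (S.eta Z) p)
        - dirDeriv X (S.g.app Y Z) p) • S.ξ p
      - S.eta Z p • S.g.nabla X Y p - dirDeriv X (S.eta Z) p • Y p := by
  have dX := hX.mdifferentiableAt two_ne_zero
  have dY := hY.mdifferentiableAt two_ne_zero
  have dZ := hZ.mdifferentiableAt two_ne_zero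
  have dN := S.g.diffAt_nabla hY hZ
  have dEY := S.mdifferentiableAt_eta dY
  have dEZ := S.mdifferentiableAt_eta dZ
  have dG := S.g.app_mdifferentiableAt dY dZ
  have hc : ∀ c : ℝ, MDifferentiableAt (𝓡 (2 * n + 1)) 𝓘(ℝ, ℝ) (fun _ : M ↦ c) p :=
    fun c ↦ mdifferentiableAt_const
  let f : M → ℝ := fun q ↦ 2 * (S.eta Y q * S.eta Z q) + -S.g.app Y Z q
  let h : M → ℝ := fun q ↦ -S.eta Z q
  have dEE : MDifferentiableAt (𝓡 (2 * n + 1)) 𝓘(ℝ, ℝ) (fun q ↦ S.eta Y q * S.eta Z q) p :=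
    dEY.mul dEZ
  have df1 : MDifferentiableAt (𝓡 (2 * n + 1)) 𝓘(ℝ, ℝ) (fun q ↦ 2 * (S.eta Y q * S.eta Z q)) p :=
    (hc 2).mul dEE
  have dG' : MDifferentiableAt (𝓡 (2 * n + 1)) 𝓘(ℝ, ℝ) (fun q ↦ -S.g.app Y Z q) p := dG.neg
  have df : MDifferentiableAt (𝓡 (2 * n + 1)) 𝓘(ℝ, ℝ) f p := df1.add dG'
  have dh : MDifferentiableAt (𝓡 (2 * n + 1)) 𝓘(ℝ, ℝ) h p := dEZ.neg
  -- The structure equation as an identity of fields near `p`, with the `ξ`-terms collected in `f`.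
  have ev : S.g.nabla Y (S.phi Z) =ᶠ[𝓝 p] S.phi (S.g.nabla Y Z) + (f • S.ξ + h • Y) := by
    filter_upwards [CAt.eventually_diffAt hY two_ne_zero, CAt.eventually_diffAt hZ two_ne_zero]
      with q hYq hZq
    rw [hS.nabla_phi hYq hZq]
    change _ = S.φ q (S.g.nabla Y Z q) + (f q • S.ξ q + h q • Y q)
    simp only [f, h]
    module
  have d1 : DiffAt (f • S.ξ) p := df.smul_section S.diffAt_ξ
  have d2 : DiffAt (h • Y) p := dh.smul_section dY
  have d12 : DiffAt (f • S.ξ + h • Y) p := mdifferentiableAt_add_section d1 d2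
  have e1 : dirDeriv X f p = 2 * (S.eta Y p * dirDeriv X (S.eta Z) p
      + S.eta Z p * dirDeriv X (S.eta Y) p) - dirDeriv X (S.g.app Y Z) p := by
    rw [dirDeriv_add df1 dG', dirDeriv_neg, dirDeriv_mul (hc 2) dEE, dirDeriv_const,
      dirDeriv_mul dEY dEZ]
    ring
  rw [S.g.nabla_congr ev dX (S.g.diffAt_nabla hY (S.cAt_phi ENat.LEInfty.out hZ)),
    S.g.nabla_add dX (S.diffAt_phi dN) d12, S.g.nabla_add dX d1 d2,
    S.g.nabla_smul df dX S.diffAt_ξ, S.g.nabla_smul dh dX dY, hS.nabla_phi dX dN,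
    hS.nabla_ξ dX, e1, dirDeriv_neg]
  simp only [f, h]
  module

/-- The Ricci identity. After antisymmetrising, derivatives of `Z` survive only inside `φR(X,Y)Z`;
those of `X` and `Y` cancel against the bracket term. -/
theorem IsSasakiLike.curv_phi (hS : S.IsSasakiLike) (hX : CAt 2 X p) (hY : CAt 2 Y p)
    (hZ : CAt 2 Z p) :
    S.g.curv X Y (S.phi Z) p = S.φ p (S.g.curv X Y Z p)
      + (S.g.app Y Z p - 2 * S.eta Y p * S.eta Z p) • S.φ p (X p)
      + S.g.app X (S.phi Z) p • (Y p - (2 * S.eta Y p) • S.ξ p)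
      - (S.g.app X Z p - 2 * S.eta X p * S.eta Z p) • S.φ p (Y p)
      - S.g.app Y (S.phi Z) p • (X p - (2 * S.eta X p) • S.ξ p) := by
  have dX := hX.mdifferentiableAt two_ne_zero
  have dY := hY.mdifferentiableAt two_ne_zero
  have dZ := hZ.mdifferentiableAt two_ne_zero
  have dB := (contMDiffAt_bracket hX hY).mdifferentiableAt one_ne_zero
  have eB := S.g.nabla_sub_nabla dX dY
  rw [PseudoMetric.curv, PseudoMetric.curv, hS.nabla_nabla_phi hX hY hZ,
    hS.nabla_nabla_phi hY hX hZ, hS.nabla_phi dB dZ, hS.dirDeriv_eta dX dY, hS.dirDeriv_eta dX dZ,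
    hS.dirDeriv_eta dY dX, hS.dirDeriv_eta dY dZ, S.g.dirDeriv_app dX dY dZ,
    S.g.dirDeriv_app dY dX dZ]
  simp only [eta, PseudoMetric.app, ← eB, map_sub, _root_.sub_apply, phi]
  rw [S.g.symm p (Y p) (S.φ p (X p)), S.val_φ]
  module

/-- Differentiate `η(X) = 0` along `ξ`; the correction `g(ξ,φX) = η(φX)` vanishes. -/
theorem IsSasakiLike.horizontal_nabla_ξ (hS : S.IsSasakiLike) (hX : Smooth X) (hXh : S.Horizontal X) :
    S.Horizontal (S.g.nabla S.ξ X) := by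
  intro p
  have h := hS.dirDeriv_eta S.diffAt_ξ (hX.contMDiffAt.mdifferentiableAt (by simp) : DiffAt X p)
  have e : S.eta X = fun _ ↦ 0 := funext hXh
  rw [e, dirDeriv_const, PseudoMetric.app, S.ξ_val, phi, S.η_φ, sub_zero] at h
  exact h.symm

theorem IsSasakiLike.ricci_ξ (hS : S.IsSasakiLike) {e : Module.Basis (Fin (2 * n + 1)) ℝ (Tan n p)}
    (he : IsOrthonormal (S.g.val p) e) (hY : CAt 2 Y p) :
    S.g.ricci e Y S.ξ = 2 * (n : ℝ) * S.eta Y p := by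
  have hs : ∀ j, sgn n j * sgn n j = 1 := fun j ↦ by unfold sgn; split_ifs <;> norm_num
  -- Parseval's identity with signs. In the trace the `2n+1` diagonal terms give `(2n+1)η(Y)`, and
  -- this identity turns the rest into `-g(Y,ξ) = -η(Y)`.
  have h1 : ∀ v w, S.g.val p v w = ∑ i, sgn n i * (S.g.val p v (e i) * S.g.val p (e i) w) := by
    intro v w
    conv_lhs => rw [← e.sum_repr v]
    simp only [map_sum, map_smul, _root_.sum_apply, _root_.smul_apply, smul_eq_mul]
    refine Finset.sum_congr rfl fun i _ ↦ ?_
    conv_rhs => rw [← e.sum_repr v]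
    simp only [map_sum, map_smul, _root_.sum_apply, _root_.smul_apply, smul_eq_mul, he _ _,
      mul_ite, mul_zero, Finset.sum_ite_eq', Finset.mem_univ, if_true]
    linear_combination -(e.repr v i * S.g.val p (e i) w) * hs i
  have h2 : ∀ i, sgn n i * S.g.curv₄ (FiberBundle.extend (Model n) (e i)) Y S.ξ
      (FiberBundle.extend (Model n) (e i)) p =
      S.eta Y p - sgn n i * (S.g.val p (Y p) (e i) * S.g.val p (e i) (S.ξ p)) := by
    intro i
    rw [PseudoMetric.curv₄, hS.curv_ξ (FiberBundle.contMDiffAt_extend _ _ _) hY]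
    simp only [eta, FiberBundle.extend_apply_self, map_sub, map_smul, _root_.sub_apply,
      _root_.smul_apply, smul_eq_mul, he i i, if_true, S.val_ξ]
    linear_combination S.η p (Y p) * hs i
  rw [PseudoMetric.ricci, Finset.sum_congr rfl fun i _ ↦ h2 i, Finset.sum_sub_distrib, ← h1,
    S.val_ξ]
  simp [eta]
  ring

end AlmostContactComplexRiemannian

end SasakiLike

end

theorem proposition4p1 (n : ℕ) (M : Type*) [TopologicalSpace M] [T2Space M]
    [ChartedSpace (SasakiLike.Model n) M] [IsManifold (𝓡 (2 * n + 1)) ∞ M]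
    (S : SasakiLike.AlmostContactComplexRiemannian n M) (hS : S.IsSasakiLike) :
    -- the formula for `R(x,y,φz,u) - R(x,y,z,φu)`
    (∀ x y z u : SasakiLike.VField n M, SasakiLike.Smooth x → SasakiLike.Smooth y →
      SasakiLike.Smooth z → SasakiLike.Smooth u → ∀ p : M,
      S.g.curv₄ x y (S.phi z) u p - S.g.curv₄ x y z (S.phi u) p =
        (S.g.app y z p - 2 * S.eta y p * S.eta z p) * S.g.app x (S.phi u) p
        + (S.g.app y u p - 2 * S.eta y p * S.eta u p) * S.g.app x (S.phi z) p
        - (S.g.app x z p - 2 * S.eta x p * S.eta z p) * S.g.app y (S.phi u) p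
        - (S.g.app x u p - 2 * S.eta x p * S.eta u p) * S.g.app y (S.phi z) p) ∧
    -- `R(x,y)ξ = η(y)x - η(x)y`
    (∀ x y : SasakiLike.VField n M, SasakiLike.Smooth x → SasakiLike.Smooth y → ∀ p : M,
      S.g.curv x y S.ξ p = S.eta y p • x p - S.eta x p • y p) ∧
    -- for horizontal `X`: `[X,ξ] ∈ H`, `∇_ξ X = -φX - [X,ξ] ∈ H` and `R(ξ,X)ξ = -X`
    (∀ X : SasakiLike.VField n M, SasakiLike.Smooth X → S.Horizontal X →
      S.Horizontal (SasakiLike.bracket X S.ξ) ∧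
      (∀ p : M, S.g.nabla S.ξ X p = -S.phi X p - SasakiLike.bracket X S.ξ p) ∧
      S.Horizontal (S.g.nabla S.ξ X) ∧
      (∀ p : M, S.g.curv S.ξ X S.ξ p = -X p)) ∧
    -- `Ric(y,ξ) = 2n η(y)` and `Ric(ξ,ξ) = 2n`, in every orthonormal basis `e` of `T_p M`
    (∀ (p : M) (e : Module.Basis (Fin (2 * n + 1)) ℝ (SasakiLike.Tan n p)),
      SasakiLike.IsOrthonormal (S.g.val p) e →
      (∀ y : SasakiLike.VField n M, SasakiLike.Smooth y →
        S.g.ricci e y S.ξ = 2 * (n : ℝ) * S.eta y p) ∧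
      S.g.ricci e S.ξ S.ξ = 2 * (n : ℝ)) := by
  have h2 : (2 : WithTop ℕ∞) ≤ ∞ := ENat.LEInfty.out
  have smooth_ξ : ∀ p, SasakiLike.CAt 2 S.ξ p := fun p ↦ S.smooth_ξ.contMDiffAt.of_le h2
  refine ⟨fun x y z u hx hy hz _ p ↦ ?_, fun x y hx hy p ↦ ?_, fun X hX hXh ↦ ?_, fun p e he ↦ ?_⟩
  · rw [SasakiLike.PseudoMetric.curv₄, hS.curv_phi (hx.contMDiffAt.of_le h2)
      (hy.contMDiffAt.of_le h2) (hz.contMDiffAt.of_le h2), SasakiLike.PseudoMetric.curv₄]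
    -- Self-adjointness moves `φ` from `R(x,y)z` onto `u`, and `g(ξ,u) = η(u)` produces the `η ⊗ η`
    -- corrections.
    simp only [SasakiLike.PseudoMetric.app, SasakiLike.AlmostContactComplexRiemannian.phi,
      SasakiLike.AlmostContactComplexRiemannian.eta, map_add, map_sub, map_smul, _root_.add_apply,
      _root_.sub_apply, _root_.smul_apply, smul_eq_mul, S.val_φ, S.ξ_val]
    ring
  · exact hS.curv_ξ (hx.contMDiffAt.of_le h2) (hy.contMDiffAt.of_le h2)
  · have dX : ∀ p, SasakiLike.DiffAt X p := fun p ↦ hX.contMDiffAt.mdifferentiableAt (by simp)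
    have hb : ∀ p, SasakiLike.bracket X S.ξ p = -S.φ p (X p) - S.g.nabla S.ξ X p := fun p ↦ by
      rw [← S.g.nabla_sub_nabla (dX p) S.diffAt_ξ, hS.nabla_ξ (dX p)]
    have hH := hS.horizontal_nabla_ξ hX hXh
    refine ⟨fun p ↦ ?_, fun p ↦ ?_, hH, fun p ↦ ?_⟩
    · have := hH p
      rw [SasakiLike.AlmostContactComplexRiemannian.eta] at this ⊢
      rw [hb, map_sub, map_neg, S.η_φ, this, neg_zero, sub_zero]
    · rw [hb, SasakiLike.AlmostContactComplexRiemannian.phi]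
      abel
    · rw [hS.curv_ξ (smooth_ξ p) (hX.contMDiffAt.of_le h2), hXh p]
      simp [SasakiLike.AlmostContactComplexRiemannian.eta, S.η_ξ]
  · refine ⟨fun y hy ↦ hS.ricci_ξ he (hy.contMDiffAt.of_le h2), ?_⟩
    rw [hS.ricci_ξ he (smooth_ξ p), SasakiLike.AlmostContactComplexRiemannian.eta, S.η_ξ, mul_one]
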